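/- Theorem. A deck of $n$ cards, labelled $1,\dots,n$ from top to bottom, is given one single-shelf shuffle: cards are drawn from the bottom of the deck one at a time, and each is placed on the top or at the bottom of a pile, independently and with probability $1/2$ each. Position $1$ is the top of the resulting deck. Put $h=\lceil n/2\rceil$. Let $\alpha_n=n/3$, $\lfloor n/3\rfloor$, $\lceil n/3\rceil$ according as $n\equiv 0,1,2 \pmod 3$. Let $m=m_n\ge 0$ be the integer with $(2m)^2+1\le n<(2m+2)^2+1$ if $n$ is odd, and with $(2m+1)^2+1\le n<(2m+3)^2+1$ if $n\ge 2$ is even. A player without feedback follows the conjectured best strategy: for $1\le j\le h$, both in position $j$ and in position $n+1-j$ the player guesses a card listed for $j$ (the two guesses may differ). The cards listed for $j$ are * $2j-2$ and $2j-1$, if $1\le j\le\alpha_n$; * $2j-1$, if $\alpha_n+1\le j\le h-m-1$; * $n-1$ and $n$, and if $n-1$ is a perfect square also $n-3$ and $n-2$, if $j=h-m$; * $n-1$ and $n$, if $h-m+1\le j\le h$. Numbers outside $\{1,\dots,n\}$ are disregarded; if several lines apply to $j$ (this happens only for $n=2$ and $n=5$), the cards of each of them are listed. Let $E(n)$ be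 the expected number of positions guessed correctly, and let $$C_n=2\sum_{j=1}^{h-m-1}\frac{\binom{2j-2}{\,n-j\,}}{2^{2j-1}} .$$ Then, for every choice among the listed guesses for each $n$, as $n\to\infty$, $$E(n)\sim\sqrt{\tfrac{2}{\pi}}\,\sqrt{n-\sqrt n}+2\Phi(1)-1+C_n ,\qquad C_n\lesssim e^{-2}(2\pi)^{-1/2}(n-\sqrt n)^{1/2} .$$ Here $\Phi$ is the distribution function of the standard normal law, $a_n\sim b_n$ means that $a_n-b_n=o(b_n)$, and $a_n\lesssim b_n$ means that for every $\varepsilon>0$ one has $a_n\le(1+\varepsilon)b_n$ for all sufficiently large $n$. -/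

import Mathlib

open Filter Asymptotics ProbabilityTheory

/-- The deck, listed from top to bottom, that a single-shelf shuffle produces from the deck
`1, 2, …, n`. The cards are drawn from the bottom (card `n` first, card `1` last), and the card
`i + 1` is placed on the top of the pile if `ω i` is `true` and at its bottom if `ω i` is `false`. -/
def shelfShuffle (n : ℕ) (ω : Fin n → Bool) : List ℕ :=
  (List.finRange n).foldr
    (fun i pile => if ω i = true then ((i : ℕ) + 1) :: pile else pile ++ [(i : ℕ) + 1]) []

/-- The number of positions `j ∈ {1, …, n}` at which the deck `d` shows the guessed card `g j`.
Position `1` is the top of the deck. -/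
def correctGuesses (n : ℕ) (g : ℕ → ℕ) (d : List ℕ) : ℕ :=
  ((Finset.Icc 1 n).filter (fun j => d[j - 1]? = some (g j))).card

/-- The expected number of correct guesses in a deck of `n` cards after one single-shelf shuffle
(independent fair coins `ω i`), when card `g j` is guessed in position `j`, with no feedback. -/
noncomputable def expectedCorrect (n : ℕ) (g : ℕ → ℕ) : ℝ :=
  (∑ ω : Fin n → Bool, (correctGuesses n g (shelfShuffle n ω) : ℝ)) / 2 ^ n

/-- `n / 3`, rounded down if `n ≡ 1 (mod 3)` and rounded up if `n ≡ 2 (mod 3)`. -/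
def guessAlpha (n : ℕ) : ℕ := if n % 3 = 2 then n / 3 + 1 else n / 3

/-- The parameter `m` of the strategy: for odd `n` the natural number with
`(2m)² + 1 ≤ n < (2(m+1))² + 1`, for even `n ≥ 2` the one with
`(2m+1)² + 1 ≤ n < (2(m+1)+1)² + 1`. -/
def guessParam (n : ℕ) : ℕ :=
  if Odd n then Nat.sqrt (n - 1) / 2 else (Nat.sqrt (n - 1) - 1) / 2

theorem guessParam_odd {n m : ℕ} (hn : Odd n) :
    guessParam n = m ↔ (2 * m) ^ 2 + 1 ≤ n ∧ n < (2 * (m + 1)) ^ 2 + 1 := by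
  have h0 : 1 ≤ n := hn.pos
  have h1 : 2 * m ≤ Nat.sqrt (n - 1) ↔ (2 * m) ^ 2 ≤ n - 1 := Nat.le_sqrt'
  have h2 : Nat.sqrt (n - 1) < 2 * (m + 1) ↔ n - 1 < (2 * (m + 1)) ^ 2 := Nat.sqrt_lt'
  rw [guessParam, if_pos hn]
  omega

theorem guessParam_even {n m : ℕ} (hn : Even n) (h0 : n ≠ 0) :
    guessParam n = m ↔ (2 * m + 1) ^ 2 + 1 ≤ n ∧ n < (2 * (m + 1) + 1) ^ 2 + 1 := by
  have h1 : 2 * m + 1 ≤ Nat.sqrt (n - 1) ↔ (2 * m + 1) ^ 2 ≤ n - 1 := Nat.le_sqrt'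
  have h2 : Nat.sqrt (n - 1) < 2 * (m + 1) + 1 ↔ n - 1 < (2 * (m + 1) + 1) ^ 2 := Nat.sqrt_lt'
  have h3 : 1 ≤ Nat.sqrt (n - 1) ↔ 1 ^ 2 ≤ n - 1 := Nat.le_sqrt'
  have h4 : n % 2 = 0 := Nat.even_iff.mp hn
  rw [guessParam, if_neg (Nat.not_odd_iff_even.mpr hn)]
  omega

/-- The exceptional deck sizes: `n = (2m)² + 1` (odd) and `n = (2m+1)² + 1` (even), that is,
the numbers `k² + 1`. -/
def IsExceptionalSize (n : ℕ) : Prop := ∃ k : ℕ, n = k ^ 2 + 1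

/-- Card `i` is one of the guesses that the conjectured strategy lists for the position `j` in the
first half `1 ≤ j ≤ ⌈n/2⌉` of a deck of `n` cards. With `m = guessParam n` and `h = ⌈n/2⌉`:
cards `2j-2, 2j-1` for `1 ≤ j ≤ α`; card `2j-1` for `α + 1 ≤ j ≤ h - m - 1`; at `j = h - m` the
cards `n-3, …, n` if the size is exceptional and `n-1, n` otherwise; cards `n-1, n` for
`h - m + 1 ≤ j ≤ h`. Only the numbers `1, …, n` are cards. -/
def IsListedGuess (n j i : ℕ) : Prop :=
  (1 ≤ i ∧ i ≤ n) ∧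
  ((1 ≤ j ∧ j ≤ guessAlpha n ∧ (i + 2 = 2 * j ∨ i + 1 = 2 * j)) ∨
   (guessAlpha n + 1 ≤ j ∧ j + guessParam n + 1 ≤ (n + 1) / 2 ∧ i + 1 = 2 * j) ∨
   (j + guessParam n = (n + 1) / 2 ∧ IsExceptionalSize n ∧ n ≤ i + 3) ∨
   (j + guessParam n = (n + 1) / 2 ∧ n ≤ i + 1) ∨
   ((n + 1) / 2 + 1 ≤ j + guessParam n ∧ j ≤ (n + 1) / 2 ∧ n ≤ i + 1))

/-- `g` follows the conjectured best no-feedback strategy for `n` cards: in each position of the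
first half it guesses a listed card, and the second half mirrors the first one, so that
the cards listed for position `n + 1 - j` are those listed for position `j`. -/
def IsConjecturedStrategy (n : ℕ) (g : ℕ → ℕ) : Prop :=
  ∀ j : ℕ, 1 ≤ j → j ≤ (n + 1) / 2 →
    IsListedGuess n j (g j) ∧ IsListedGuess n j (g (n + 1 - j))

/-- The term `C_n`: twice the sum, over the positions `1 ≤ j ≤ ⌈n/2⌉ - m - 1` where card `2j-1` is
guessed, of the probability `binom(2j-2, n-j) / 2^(2j-1)` that card `2j-1` is placed at the bottom
of the pile and ends in position `j`. -/
noncomputable def bottomTerm (n : ℕ) : ℝ :=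
  2 * ∑ j ∈ Finset.Icc 1 ((n + 1) / 2 - guessParam n - 1),
    ((2 * j - 2).choose (n - j) : ℝ) / 2 ^ (2 * j - 1)

/-- `u ≲ v`: asymptotically, `u n` is at most `v n` up to a factor tending to `1`. -/
def AsympLE (u v : ℕ → ℝ) : Prop :=
  ∀ ε : ℝ, 0 < ε → ∀ᶠ n : ℕ in atTop, u n ≤ (1 + ε) * v n

/-! By linearity the expected score is a sum of probabilities that a given card lands in a given
position, and `positionCount_eq` gives these in closed form. Away from the middle all listed cards
for a position have the same probability, so the choice is immaterial; mirrored positions then add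
up to `S + bottomTerm n`, with `S` a sum of central binomial probabilities. The middle guesses use
only the last four cards, hence contribute at most 4 (`expectedCorrect_bounds`). A renewal argument
gives `bottomTerm n ≤ 1`, and Wallis' product gives `S ~ √(2n/π)`. Only the order `√n` matters: the
normal-law constant and `bottomTerm` are negligible in the equivalence, and the second claim
compares a bounded sequence with a divergent one. -/

/-! ### The law of a card's position. -/

theorem shelfShuffle_cons (n : ℕ) (b : Bool) (ω : Fin n → Bool) :
    shelfShuffle (n + 1) (Fin.cons b ω : Fin (n + 1) → Bool) =
      if b = true then 1 :: (shelfShuffle n ω).map (· + 1)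
      else (shelfShuffle n ω).map (· + 1) ++ [1] := by
  have key : ∀ l : List (Fin n),
      (l.map Fin.succ).foldr (fun (i : Fin (n + 1)) pile =>
        if (Fin.cons b ω : Fin (n + 1) → Bool) i = true then ((i : ℕ) + 1) :: pile
        else pile ++ [(i : ℕ) + 1]) [] =
      (l.foldr (fun i pile => if ω i = true then ((i : ℕ) + 1) :: pile
        else pile ++ [(i : ℕ) + 1]) []).map (· + 1) := by
    intro l
    induction l with
    | nil => rfl
    | cons a l ih =>
      simp only [List.map_cons, List.foldr_cons, ih, Fin.cons_succ, Fin.val_succ]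
      split_ifs <;> simp
  rw [shelfShuffle, List.finRange_succ, List.foldr_cons, key, shelfShuffle]
  simp

theorem shelfShuffle_length (n : ℕ) (ω : Fin n → Bool) : (shelfShuffle n ω).length = n := by
  induction n with
  | zero => rfl
  | succ n ih =>
    rw [← Fin.cons_self_tail ω, shelfShuffle_cons]
    split_ifs <;> simp [ih]

theorem zero_notMem_shelfShuffle (n : ℕ) (ω : Fin n → Bool) : 0 ∉ shelfShuffle n ω := by
  cases n with
  | zero => simp [shelfShuffle]
  | succ n =>
    rw [← Fin.cons_self_tail ω, shelfShuffle_cons]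
    split_ifs <;> simp

/-- The number of coin sequences for which card `c + 1` ends up below exactly `k` cards. -/
def positionCount (n k c : ℕ) : ℕ :=
  ∑ ω : Fin n → Bool, if (shelfShuffle n ω)[k]? = some (c + 1) then 1 else 0

theorem sum_coins_succ {M : Type*} [AddCommMonoid M] (n : ℕ) (f : (Fin (n + 1) → Bool) → M) :
    ∑ ω, f ω = ∑ ω : Fin n → Bool, f (Fin.cons true ω) + ∑ ω : Fin n → Bool, f (Fin.cons false ω) := by
  rw [← (Fin.consEquiv (fun _ : Fin (n + 1) => Bool)).sum_comp, Fintype.sum_prod_type]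
  simp [Fin.consEquiv]

theorem positionCount_of_le {n k : ℕ} (h : n ≤ k) (c : ℕ) : positionCount n k c = 0 := by
  refine Finset.sum_eq_zero fun ω _ => ?_
  rw [List.getElem?_eq_none (by rw [shelfShuffle_length]; exact h)]
  simp

theorem positionCount_succ_zero (n k : ℕ) :
    positionCount (n + 1) k 0 = 2 ^ n * ((if k = 0 then 1 else 0) + if k = n then 1 else 0) := by
  have h1 : ∀ ω : Fin n → Bool, ((1 :: (shelfShuffle n ω).map (· + 1))[k]? = some (0 + 1)) ↔
      k = 0 := by
    intro ω
    cases k with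
    | zero => simp
    | succ k => simpa using fun h => zero_notMem_shelfShuffle n ω (List.mem_of_getElem? h)
  have h2 : ∀ ω : Fin n → Bool, (((shelfShuffle n ω).map (· + 1) ++ [1])[k]? = some (0 + 1)) ↔
      k = n := by
    intro ω
    rw [List.getElem?_append]
    simp only [List.length_map, shelfShuffle_length, List.getElem?_map]
    split_ifs with h
    · have h0 : (shelfShuffle n ω)[k]? ≠ some 0 := fun h0 =>
        zero_notMem_shelfShuffle n ω (List.mem_of_getElem? h0)
      simpa [h0] using h.ne
    · rw [List.getElem?_singleton]
      split_ifs with h' <;> simp <;> omega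
  simp only [positionCount, sum_coins_succ, shelfShuffle_cons, if_true, Bool.false_eq_true,
    if_false, h1, h2]
  simp [mul_add]

theorem positionCount_succ_succ_zero (n c : ℕ) :
    positionCount (n + 1) 0 (c + 1) = positionCount n 0 c := by
  simp only [positionCount, sum_coins_succ, shelfShuffle_cons, if_true, Bool.false_eq_true,
    if_false]
  rw [Finset.sum_eq_zero (by simp), zero_add]
  refine Finset.sum_congr rfl fun ω _ => ?_
  cases shelfShuffle n ω <;> simp

theorem positionCount_succ_succ_succ (n k c : ℕ) :
    positionCount (n + 1) (k + 1) (c + 1) = positionCount n k c + positionCount n (k + 1) c := by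
  simp only [positionCount, sum_coins_succ, shelfShuffle_cons, if_true, Bool.false_eq_true,
    if_false]
  congr 1
  · simp
  · refine Finset.sum_congr rfl fun ω _ => ?_
    congr 1
    rw [List.getElem?_append]
    simp only [List.length_map, shelfShuffle_length, List.getElem?_map]
    split_ifs with h
    · simp
    · rw [List.getElem?_eq_none (l := shelfShuffle n ω) (by rw [shelfShuffle_length]; omega),
        List.getElem?_singleton]
      split_ifs <;> simp

/-- Exactly `c` cards are drawn after card `c + 1`. If it goes on top, `k` of them must go on top;
if it goes to the bottom, `n - 1 - k` of them must go below it. The other `n - 1 - c` coins are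
free. The induction removes card `1`, the last one drawn, and is Pascal's rule in both terms. -/
theorem positionCount_eq {n : ℕ} : ∀ {k c : ℕ}, k < n → c < n →
    positionCount n k c = 2 ^ (n - 1 - c) * (c.choose k + c.choose (n - 1 - k)) := by
  induction n with
  | zero => intro k c hk; omega
  | succ n ih =>
    intro k c hk hc
    rcases c with _ | c
    · rw [positionCount_succ_zero]
      congr 2
      · cases k <;> simp
      · rcases eq_or_ne k n with rfl | h
        · simp
        · rw [if_neg h, Nat.choose_eq_zero_of_lt (by omega)]
    · have e1 : n + 1 - 1 - (c + 1) = n - 1 - c := by omega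
      rcases k with _ | k
      · rw [positionCount_succ_succ_zero, ih (by omega) (by omega), e1]
        have : (c + 1).choose (n + 1 - 1 - 0) = c.choose (n - 1 - 0) := by
          obtain ⟨n, rfl⟩ : ∃ n', n = n' + 1 := ⟨n - 1, by omega⟩
          simp [Nat.choose_succ_succ, Nat.choose_eq_zero_of_lt (show c < n + 1 by omega)]
        rw [this]; simp
      · rw [positionCount_succ_succ_succ, ih (by omega) (by omega), e1]
        rcases Nat.lt_or_ge (k + 1) n with h | h
        · rw [ih h (by omega), ← mul_add]
          have e2 : n - 1 - k = (n - 1 - (k + 1)) + 1 := by omega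
          have e3 : n + 1 - 1 - (k + 1) = (n - 1 - (k + 1)) + 1 := by omega
          rw [e2, e3, Nat.choose_succ_succ c k, Nat.choose_succ_succ c (n - 1 - (k + 1))]
          simp only [Nat.succ_eq_add_one]
          ring
        · rw [positionCount_of_le h]
          have e2 : n - 1 - k = 0 := by omega
          have e3 : n + 1 - 1 - (k + 1) = 0 := by omega
          rw [e2, e3, Nat.choose_succ_succ c k, Nat.choose_eq_zero_of_lt (show c < k + 1 by omega)]
          simp

/-- The probability that card `c + 1` ends up below exactly `k` cards. -/
noncomputable def positionProb (n k c : ℕ) : ℝ := positionCount n k c / 2 ^ n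

theorem positionProb_nonneg (n k c : ℕ) : 0 ≤ positionProb n k c := by
  unfold positionProb; positivity

theorem positionProb_eq {n k c : ℕ} (hk : k < n) (hc : c < n) :
    positionProb n k c = ((c.choose k : ℝ) + c.choose (n - 1 - k)) / 2 ^ (c + 1) := by
  have h : (2 : ℝ) ^ n = 2 ^ (n - 1 - c) * 2 ^ (c + 1) := by
    rw [← pow_add]; congr 1; omega
  rw [positionProb, positionCount_eq hk hc, h]
  push_cast
  rw [mul_div_mul_left _ _ (by positivity)]

theorem positionProb_symm {n k c : ℕ} (hk : k < n) (hc : c < n) :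
    positionProb n (n - 1 - k) c = positionProb n k c := by
  rw [positionProb_eq hk hc, positionProb_eq (by omega) hc, add_comm]
  congr 4; omega

theorem sum_positionProb_le {n c : ℕ} (hc : c < n) :
    ∑ k ∈ Finset.range n, positionProb n k c ≤ 1 := by
  have h1 : ∑ k ∈ Finset.range n, (c.choose k : ℝ) ≤ 2 ^ c := by
    have : ∑ k ∈ Finset.range n, c.choose k = 2 ^ c := by
      rw [← Nat.sum_range_choose]
      symm
      refine Finset.sum_subset (by intro x; simp; omega) fun x _ hx => ?_
      exact Nat.choose_eq_zero_of_lt (by simpa using hx)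
    exact_mod_cast this.le
  have h2 := Finset.sum_range_reflect (fun k => (c.choose k : ℝ)) n
  rw [Finset.sum_congr rfl fun k hk => positionProb_eq (Finset.mem_range.mp hk) hc,
    ← Finset.sum_div, Finset.sum_add_distrib, h2, div_le_one (by positivity), pow_succ]
  linarith

/-! ### Reduction of the expected score to binomial sums. -/

theorem expectedCorrect_eq_sum (n : ℕ) (g : ℕ → ℕ) (hg : ∀ k < n, 1 ≤ g (k + 1)) :
    expectedCorrect n g = ∑ k ∈ Finset.range n, positionProb n k (g (k + 1) - 1) := by
  have h : ∀ d : List ℕ, correctGuesses n g d =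
      ∑ k ∈ Finset.range n, if d[k]? = some (g (k + 1) - 1 + 1) then 1 else 0 := by
    intro d
    rw [correctGuesses, Finset.card_filter, Finset.range_eq_Ico]
    have := Finset.sum_Ico_add' (fun j => if d[j - 1]? = some (g j) then 1 else 0) 0 n 1
    rw [zero_add] at this
    rw [← Finset.Ico_add_one_right_eq_Icc, ← this]
    refine Finset.sum_congr rfl fun k hk => ?_
    rw [Nat.sub_add_cancel (hg k (Finset.mem_Ico.mp hk).2), Nat.add_sub_cancel]
  rw [expectedCorrect]
  simp only [positionProb, positionCount, h, ← Finset.sum_div]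
  push_cast
  rw [Finset.sum_comm]

/-- The number of positions `j` in the first half for which the strategy lists only cards among
`2j - 2` and `2j - 1`. -/
def guessMain (n : ℕ) : ℕ := (n + 1) / 2 - guessParam n - 1

theorem two_mul_guessParam_le (n : ℕ) : 2 * guessParam n ≤ Nat.sqrt (n - 1) := by
  unfold guessParam; split_ifs <;> omega

theorem guessAlpha_add_guessParam_lt {n : ℕ} (hn : 26 ≤ n) :
    guessAlpha n + guessParam n < (n + 1) / 2 := by
  have h1 := two_mul_guessParam_le n
  have h2 : Nat.sqrt (n - 1) ^ 2 ≤ n - 1 := Nat.sqrt_le' _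
  -- From `26 ≤ n`: the parameter is then at most `(n - 1) / 10`, which fits in the gap of about `n
  -- / 6` between `guessAlpha n` and `n / 2`.
  have h3 : 5 ≤ Nat.sqrt (n - 1) := by rw [Nat.le_sqrt']; omega
  have h4 : 5 * Nat.sqrt (n - 1) ≤ Nat.sqrt (n - 1) ^ 2 := by nlinarith
  unfold guessAlpha
  split_ifs <;> omega

theorem two_mul_choose_two_mul_sub_one {k : ℕ} (hk : 1 ≤ k) :
    2 * (2 * k - 1).choose k = (2 * k).choose k := by
  obtain ⟨t, rfl⟩ : ∃ t, k = t + 1 := ⟨k - 1, by omega⟩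
  have e : 2 * (t + 1) = 2 * t + 1 + 1 := by ring
  rw [e, Nat.choose_succ_succ, Nat.add_sub_cancel, Nat.succ_eq_add_one, Nat.choose_symm_half]
  ring

/-- Both candidates agree: `2 * (2k-1).choose k = (2k).choose k` matches the top terms, and where
two cards are listed `k + 1 ≤ guessAlpha n` forces `2k < n - 1 - k`, so the bottom terms vanish. -/
theorem positionProb_listed {n k i : ℕ} (hk : k < guessMain n) (hi : IsListedGuess n (k + 1) i) :
    positionProb n k (i - 1) =
      ((2 * k).choose k : ℝ) / 2 ^ (2 * k + 1) + ((2 * k).choose (n - 1 - k) : ℝ) / 2 ^ (2 * k + 1) := by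
  unfold guessMain at hk
  obtain ⟨⟨hi1, hin⟩, hi⟩ := hi
  rw [positionProb_eq (by omega) (by omega)]
  have hcases : i - 1 = 2 * k ∨ (1 ≤ k ∧ i - 1 = 2 * k - 1 ∧ k + 1 ≤ guessAlpha n) := by
    omega
  rcases hcases with h | ⟨hk1, h, hα⟩
  · rw [h, add_div]
  · have h3 : 3 * k + 1 < n := by
      unfold guessAlpha at hα
      split_ifs at hα <;> omega
    rw [h, Nat.choose_eq_zero_of_lt (show 2 * k - 1 < n - 1 - k by omega),
      Nat.choose_eq_zero_of_lt (show 2 * k < n - 1 - k by omega),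
      ← two_mul_choose_two_mul_sub_one hk1, show 2 * k - 1 + 1 = 2 * k by omega, pow_succ]
    push_cast
    field_simp
    ring

theorem exists_of_listed_middle {n j i : ℕ} (hn : 26 ≤ n) (hj : guessMain n < j)
    (hi : IsListedGuess n j i) : ∃ d < 4, i - 1 = n - 1 - d := by
  have := guessAlpha_add_guessParam_lt hn
  unfold guessMain at hj
  obtain ⟨⟨hi1, hin⟩, hi⟩ := hi
  exact ⟨n - i, by omega, by omega⟩

theorem bottomTerm_eq (n : ℕ) : bottomTerm n =
    2 * ∑ k ∈ Finset.range (guessMain n), ((2 * k).choose (n - 1 - k) : ℝ) / 2 ^ (2 * k + 1) := by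
  have := Finset.sum_Ico_add' (fun j => ((2 * j - 2).choose (n - j) : ℝ) / 2 ^ (2 * j - 1)) 0
    (guessMain n) 1
  rw [zero_add] at this
  rw [bottomTerm, ← guessMain, ← Finset.Ico_add_one_right_eq_Icc, ← this, Finset.range_eq_Ico]
  congr 1
  refine Finset.sum_congr rfl fun k hk => ?_
  rw [show 2 * (k + 1) - 2 = 2 * k by omega, show n - (k + 1) = n - 1 - k by omega,
    show 2 * (k + 1) - 1 = 2 * k + 1 by omega]

theorem bottomTerm_nonneg (n : ℕ) : 0 ≤ bottomTerm n := by
  unfold bottomTerm; positivity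

/-- Up to a bounded error from the middle positions, the expected number of correct guesses is a
sum of central binomial probabilities plus `bottomTerm n`. -/
theorem expectedCorrect_bounds {n : ℕ} (hn : 26 ≤ n) {g : ℕ → ℕ} (hg : IsConjecturedStrategy n g) :
    let S := ∑ k ∈ Finset.range (guessMain n), ((2 * k).choose k : ℝ) / 4 ^ k
    S + bottomTerm n ≤ expectedCorrect n g ∧ expectedCorrect n g ≤ S + bottomTerm n + 4 := by
  intro S
  have hN : 2 * guessMain n ≤ n := by unfold guessMain; omega
  have hmain : ∑ k ∈ Finset.range (guessMain n),
      2 * (((2 * k).choose k : ℝ) / 2 ^ (2 * k + 1)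
        + ((2 * k).choose (n - 1 - k) : ℝ) / 2 ^ (2 * k + 1)) = S + bottomTerm n := by
    rw [bottomTerm_eq, Finset.mul_sum, ← Finset.sum_add_distrib]
    refine Finset.sum_congr rfl fun k _ => ?_
    rw [show (4 : ℝ) ^ k = 2 ^ (2 * k) by rw [pow_mul]; norm_num, pow_succ]
    field_simp
  have hone : ∀ k < n, 1 ≤ g (k + 1) := by
    intro k hk
    rcases Nat.lt_or_ge (k + 1) ((n + 1) / 2 + 1) with h | h
    · exact (hg (k + 1) (by omega) (by omega)).1.1.1
    · have := (hg (n - k) (by omega) (by omega)).2.1.1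
      rwa [show n + 1 - (n - k) = k + 1 by omega] at this
  set f : ℕ → ℝ := fun k => positionProb n k (g (k + 1) - 1) with hf
  have hfirst : ∑ k ∈ Finset.range (guessMain n), (f k + f (n - 1 - k)) = S + bottomTerm n := by
    rw [← hmain]
    refine Finset.sum_congr rfl fun k hk => ?_
    have hk := Finset.mem_range.mp hk
    have hl := hg (k + 1) (by omega) (by unfold guessMain at hk; omega)
    rw [show n + 1 - (k + 1) = n - 1 - k + 1 by omega] at hl
    have hlt : g (n - 1 - k + 1) - 1 < n := by have := hl.2.1; omega
    simp only [hf]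
    rw [positionProb_listed hk hl.1, positionProb_symm (by omega) hlt,
      positionProb_listed hk hl.2]
    ring
  have hlast : ∑ k ∈ Finset.range (guessMain n), f (n - 1 - k) =
      ∑ k ∈ Finset.Ico (n - guessMain n) n, f k := by
    have := Finset.sum_Ico_reflect f 0 (m := guessMain n) (n := n - 1) (by omega)
    rw [Finset.range_eq_Ico, this, show n - 1 + 1 = n by omega, Nat.sub_zero]
  -- Replacing the guess by all four last cards allows summing over positions first; each card has
  -- total mass at most 1.
  have hmid : ∀ k ∈ Finset.Ico (guessMain n) (n - guessMain n),
      f k ≤ ∑ d ∈ Finset.range 4, positionProb n k (n - 1 - d) := by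
    intro k hk
    have hk := Finset.mem_Ico.mp hk
    have hex : ∃ d < 4, g (k + 1) - 1 = n - 1 - d := by
      rcases Nat.lt_or_ge (k + 1) ((n + 1) / 2 + 1) with h | h
      · exact exists_of_listed_middle hn (by omega) (hg (k + 1) (by omega) (by omega)).1
      · have := (hg (n - k) (by omega) (by omega)).2
        rw [show n + 1 - (n - k) = k + 1 by omega] at this
        exact exists_of_listed_middle hn (by omega) this
    obtain ⟨d, hd, he⟩ := hex
    simp only [hf, he]
    exact Finset.single_le_sum (f := fun d => positionProb n k (n - 1 - d))
      (fun _ _ => positionProb_nonneg _ _ _) (Finset.mem_range.mpr hd)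
  have hmid_le : ∑ k ∈ Finset.Ico (guessMain n) (n - guessMain n), f k ≤ 4 := by
    calc _ ≤ ∑ k ∈ Finset.Ico (guessMain n) (n - guessMain n),
          ∑ d ∈ Finset.range 4, positionProb n k (n - 1 - d) := Finset.sum_le_sum hmid
      _ ≤ ∑ k ∈ Finset.range n, ∑ d ∈ Finset.range 4, positionProb n k (n - 1 - d) := by
          refine Finset.sum_le_sum_of_subset_of_nonneg ?_ fun _ _ _ =>
            Finset.sum_nonneg fun _ _ => positionProb_nonneg _ _ _
          intro k
          simp only [Finset.mem_Ico, Finset.mem_range]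
          omega
      _ = ∑ d ∈ Finset.range 4, ∑ k ∈ Finset.range n, positionProb n k (n - 1 - d) :=
          Finset.sum_comm
      _ ≤ ∑ d ∈ Finset.range 4, (1 : ℝ) :=
          Finset.sum_le_sum fun d _ => sum_positionProb_le (by omega)
      _ = 4 := by simp
  have hmid_nonneg : 0 ≤ ∑ k ∈ Finset.Ico (guessMain n) (n - guessMain n), f k :=
    Finset.sum_nonneg fun _ _ => positionProb_nonneg _ _ _
  have htotal : expectedCorrect n g =
      S + bottomTerm n + ∑ k ∈ Finset.Ico (guessMain n) (n - guessMain n), f k := by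
    rw [expectedCorrect_eq_sum n g hone, ← hfirst, Finset.sum_add_distrib, hlast,
      Finset.range_eq_Ico, Finset.range_eq_Ico, ← Finset.sum_Ico_consecutive f (Nat.zero_le (guessMain n)) (by omega),
      ← Finset.sum_Ico_consecutive f (show guessMain n ≤ n - guessMain n by omega) (by omega)]
    ring
  constructor <;> linarith

/-! ### Boundedness of `bottomTerm`. -/

/-- A walk with steps `1/2` and `3/2` visits each point at most once. -/
theorem sum_choose_div_four_pow_le_one (N : ℕ) :
    ∀ M, ∑ k ∈ Finset.range M, (if k ≤ N then ((2 * k).choose (N - k) : ℝ) / 4 ^ k else 0) ≤ 1 := by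
  induction N using Nat.strong_induction_on with
  | _ N ih =>
    intro M
    rcases M with _ | M
    · simp
    rw [Finset.sum_range_succ']
    rcases N with _ | N
    · simp
    -- Two steps at once advance by 1, 2 or 3 with weights 1/4, 1/2, 1/4 (Pascal's rule twice), so
    -- the bound is an average of earlier ones.
    have step : ∀ k, (if k + 1 ≤ N + 1 then ((2 * (k + 1)).choose (N + 1 - (k + 1)) : ℝ) / 4 ^ (k + 1)
          else 0) =
        ((if k ≤ N then ((2 * k).choose (N - k) : ℝ) / 4 ^ k else 0) +
        2 * (if k + 1 ≤ N then ((2 * k).choose (N - 1 - k) : ℝ) / 4 ^ k else 0) +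
        (if k + 2 ≤ N then ((2 * k).choose (N - 2 - k) : ℝ) / 4 ^ k else 0)) / 4 := by
      intro k
      have e : 2 * (k + 1) = 2 * k + 1 + 1 := by ring
      rcases Nat.lt_or_ge N k with h | h
      · rw [if_neg (by omega), if_neg (by omega), if_neg (by omega), if_neg (by omega)]; simp
      obtain ⟨r, rfl⟩ := Nat.exists_eq_add_of_le h
      have e0 : k + r + 1 - (k + 1) = r := by omega
      have e1 : k + r - k = r := by omega
      rw [if_pos (by omega), if_pos (by omega), e0, e1, e, pow_succ]
      rcases r with _ | _ | r
      · simp; ring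
      · rw [if_pos (by omega), if_neg (by omega), show k + (0 + 1) - 1 - k = 0 by omega]
        simp; field_simp; ring
      · rw [if_pos (by omega), if_pos (by omega), show k + (r + 1 + 1) - 1 - k = r + 1 by omega,
          show k + (r + 1 + 1) - 2 - k = r by omega]
        simp only [Nat.choose_succ_succ, Nat.succ_eq_add_one]
        push_cast
        field_simp
        ring
    have h2 : ∑ k ∈ Finset.range M,
        (if k + 1 ≤ N then ((2 * k).choose (N - 1 - k) : ℝ) / 4 ^ k else 0) ≤ 1 := by
      rcases N with _ | N
      · simp
      · simpa using ih N (by omega) M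
    have h3 : ∑ k ∈ Finset.range M,
        (if k + 2 ≤ N then ((2 * k).choose (N - 2 - k) : ℝ) / 4 ^ k else 0) ≤ 1 := by
      rcases N with _ | _ | N
      · simp
      · simp
      · simpa using ih N (by omega) M
    have h1 := ih N (by omega) M
    rw [Finset.sum_congr rfl fun k _ => step k, ← Finset.sum_div, Finset.sum_add_distrib,
      Finset.sum_add_distrib, ← Finset.mul_sum]
    simp only [Nat.zero_le, if_true, mul_zero, Nat.sub_zero, Nat.choose_zero_succ, Nat.cast_zero,
      zero_div, add_zero]
    linarith

theorem bottomTerm_le_one (n : ℕ) : bottomTerm n ≤ 1 := by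
  refine le_trans (le_of_eq ?_) (sum_choose_div_four_pow_le_one (n - 1) (guessMain n))
  rw [bottomTerm_eq, Finset.mul_sum]
  refine Finset.sum_congr rfl fun k hk => ?_
  have : k ≤ n - 1 := by
    have := Finset.mem_range.mp hk
    unfold guessMain at this; omega
  rw [if_pos this, show (4 : ℝ) ^ k = 2 ^ (2 * k) by rw [pow_mul]; norm_num, pow_succ]
  field_simp

/-! ### Central binomial sums and their asymptotics. -/

theorem sum_centralBinom_div (N : ℕ) :
    ∑ k ∈ Finset.range N, ((2 * k).choose k : ℝ) / 4 ^ k = 2 * N * (N.centralBinom / 4 ^ N) := by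
  induction N with
  | zero => simp
  | succ N ih =>
    have h : ((N : ℝ) + 1) * (N + 1).centralBinom = 2 * (2 * N + 1) * N.centralBinom := by
      exact_mod_cast Nat.succ_mul_centralBinom_succ N
    rw [Finset.sum_range_succ, ih, ← Nat.centralBinom_eq_two_mul_choose, pow_succ]
    push_cast
    field_simp
    linear_combination (-2 : ℝ) * h

/-- An exact finite identity, so the limit of Wallis' product yields the size of the central
binomial probability. -/
theorem centralBinom_sq_mul_wallis (N : ℕ) :
    ((N.centralBinom : ℝ) / 4 ^ N) ^ 2 * (2 * N + 1) * Real.Wallis.W N = 1 := by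
  induction N with
  | zero => simp [Real.Wallis.W]
  | succ N ih =>
    have h : ((N + 1).centralBinom : ℝ) = 2 * (2 * N + 1) * N.centralBinom / (N + 1) := by
      rw [eq_div_iff (by positivity), mul_comm]
      exact_mod_cast Nat.succ_mul_centralBinom_succ N
    refine Eq.trans ?_ ih
    rw [h, Real.Wallis.W_succ, pow_succ 4 N]
    push_cast
    field_simp
    ring

theorem tendsto_sum_centralBinom_div_sqrt {N : ℕ → ℕ}
    (hN : Tendsto (fun n : ℕ => (N n : ℝ) / n) atTop (nhds (1 / 2))) :
    Tendsto (fun n : ℕ => (∑ k ∈ Finset.range (N n), ((2 * k).choose k : ℝ) / 4 ^ k) / √(n : ℝ))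
      atTop (nhds √(2 / Real.pi)) := by
  have hNtop : Tendsto (fun n => (N n : ℝ)) atTop atTop := by
    have := hN.pos_mul_atTop (by norm_num) (tendsto_natCast_atTop_atTop (R := ℝ))
    refine this.congr' ?_
    filter_upwards [eventually_gt_atTop 0] with n hn
    field_simp
  have hW : Tendsto (fun n => Real.Wallis.W (N n)) atTop (nhds (Real.pi / 2)) :=
    Real.Wallis.tendsto_W_nhds_pi_div_two.comp (tendsto_natCast_atTop_iff.mp hNtop)
  have hinv : Tendsto (fun n => 1 / (N n : ℝ)) atTop (nhds 0) :=
    hNtop.const_div_atTop 1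
  -- The radicand is the square of the quotient in the goal, rewritten by the two preceding
  -- identities.
  have hlim : Tendsto (fun n : ℕ => √(4 * ((N n : ℝ) / n) / (2 + 1 / (N n : ℝ)) /
      Real.Wallis.W (N n))) atTop (nhds √(4 * (1 / 2) / (2 + 0) / (Real.pi / 2))) :=
    (Real.continuous_sqrt.tendsto _).comp
      ((((hN.const_mul 4).div (hinv.const_add 2) (by norm_num))).div hW (by positivity))
  rw [show 4 * (1 / 2) / (2 + 0) / (Real.pi / 2) = 2 / Real.pi by field_simp; norm_num] at hlim
  refine hlim.congr' ?_
  filter_upwards [eventually_gt_atTop 0, hNtop.eventually_gt_atTop 0] with n hn hNn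
  have hn' : (0 : ℝ) < n := by exact_mod_cast hn
  rw [sum_centralBinom_div, eq_div_iff (by positivity), ← Real.sqrt_mul' _ hn'.le]
  rw [Real.sqrt_eq_iff_eq_sq _ (by positivity)]
  · have hWp := Real.Wallis.W_pos (N n)
    have := centralBinom_sq_mul_wallis (N n)
    field_simp
    field_simp at this
    linear_combination (-4 : ℝ) * this
  · have hWp := Real.Wallis.W_pos (N n)
    positivity

theorem tendsto_guessMain_div : Tendsto (fun n : ℕ => (guessMain n : ℝ) / n) atTop (nhds (1 / 2)) := by
  have hinv : Tendsto (fun n : ℕ => 1 / √(n : ℝ)) atTop (nhds 0) :=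
    (Real.tendsto_sqrt_atTop.comp tendsto_natCast_atTop_atTop).const_div_atTop 1
  have hlow : Tendsto (fun n : ℕ => (1 / 2 : ℝ) - 3 * (1 / √(n : ℝ))) atTop (nhds (1 / 2)) := by
    simpa using (hinv.const_mul 3).const_sub (1 / 2 : ℝ)
  refine tendsto_of_tendsto_of_tendsto_of_le_of_le' hlow tendsto_const_nhds ?_ ?_
  · filter_upwards [eventually_ge_atTop 1] with n hn
    have hn' : (1 : ℝ) ≤ n := by exact_mod_cast hn
    have h1 : n ≤ 2 * guessMain n + Nat.sqrt (n - 1) + 2 := by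
      have := two_mul_guessParam_le n
      unfold guessMain; omega
    have h2 : (Nat.sqrt (n - 1) : ℝ) ≤ √(n : ℝ) :=
      Real.nat_sqrt_le_real_sqrt.trans (Real.sqrt_le_sqrt (by exact_mod_cast Nat.sub_le n 1))
    have h3 : (n : ℝ) ≤ 2 * guessMain n + Nat.sqrt (n - 1) + 2 := by exact_mod_cast h1
    have h4 : (1 : ℝ) ≤ √(n : ℝ) := Real.one_le_sqrt.mpr hn'
    have h5 : √(n : ℝ) * √(n : ℝ) = n := Real.mul_self_sqrt (by positivity)
    rw [le_div_iff₀ (by positivity)]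
    have h6 : 1 / √(n : ℝ) * n = √(n : ℝ) := by
      rw [one_div_mul_eq_div, div_eq_iff (by positivity), h5]
    rw [sub_mul, mul_assoc, h6]
    linarith
  · filter_upwards [eventually_ge_atTop 1] with n hn
    have hn' : (1 : ℝ) ≤ n := by exact_mod_cast hn
    have h1 : 2 * guessMain n ≤ n := by unfold guessMain; omega
    have h2 : 2 * (guessMain n : ℝ) ≤ n := by exact_mod_cast h1
    rw [div_le_iff₀ (by positivity)]
    linarith

theorem tendsto_sqrt_sub_sqrt_div_sqrt :
    Tendsto (fun n : ℕ => √((n : ℝ) - √(n : ℝ)) / √(n : ℝ)) atTop (nhds 1) := by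
  have hinv : Tendsto (fun n : ℕ => 1 / √(n : ℝ)) atTop (nhds 0) :=
    (Real.tendsto_sqrt_atTop.comp tendsto_natCast_atTop_atTop).const_div_atTop 1
  have h := (Real.continuous_sqrt.tendsto _).comp (hinv.const_sub 1)
  rw [sub_zero, Real.sqrt_one] at h
  refine h.congr' ?_
  filter_upwards [eventually_ge_atTop 1] with n hn
  have hn' : (0 : ℝ) < n := by exact_mod_cast hn
  have h5 : √(n : ℝ) * √(n : ℝ) = n := Real.mul_self_sqrt hn'.le
  rw [Function.comp_apply, ← Real.sqrt_div' _ hn'.le]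
  congr 1
  rw [sub_div, div_self hn'.ne', sub_right_inj, div_eq_div_iff (by positivity) hn'.ne', h5, one_mul]

/-! ### Comparison at scale `√n`. -/

theorem theorem1p3 (g : ℕ → ℕ → ℕ) (hg : ∀ n : ℕ, IsConjecturedStrategy n (g n)) :
    (fun n : ℕ => expectedCorrect n (g n)) ~[atTop]
      (fun n : ℕ => Real.sqrt (2 / Real.pi) * Real.sqrt ((n : ℝ) - Real.sqrt (n : ℝ))
        + 2 * (cdf (gaussianReal 0 1) : ℝ → ℝ) 1 - 1 + bottomTerm n) ∧
    AsympLE bottomTerm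
      (fun n : ℕ => Real.exp (-2) * (2 * Real.pi) ^ (-(1 / 2) : ℝ)
        * ((n : ℝ) - Real.sqrt (n : ℝ)) ^ ((1 / 2) : ℝ)) := by
  set a : ℝ := 2 * (cdf (gaussianReal 0 1) : ℝ → ℝ) 1 - 1 with ha
  set s : ℝ := √(2 / Real.pi) with hs
  have hs0 : 0 < s := by positivity
  have hsqrt : Tendsto (fun n : ℕ => √(n : ℝ)) atTop atTop :=
    Real.tendsto_sqrt_atTop.comp tendsto_natCast_atTop_atTop
  have hdiv : ∀ {c : ℝ} {u : ℕ → ℝ}, (∀ᶠ n in atTop, 0 ≤ u n) → (∀ᶠ n in atTop, u n ≤ c) →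
      Tendsto (fun n : ℕ => u n / √(n : ℝ)) atTop (nhds 0) := by
    intro c u h0 h1
    refine tendsto_of_tendsto_of_tendsto_of_le_of_le' tendsto_const_nhds
      (hsqrt.const_div_atTop c) ?_ ?_
    · filter_upwards [h0] with n hn using by positivity
    · filter_upwards [h1] with n hn using by gcongr
  have hgrow := tendsto_sqrt_sub_sqrt_div_sqrt
  constructor
  · set S : ℕ → ℝ := fun n => ∑ k ∈ Finset.range (guessMain n), ((2 * k).choose k : ℝ) / 4 ^ k
    have hS : Tendsto (fun n => S n / √(n : ℝ)) atTop (nhds s) :=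
      tendsto_sum_centralBinom_div_sqrt tendsto_guessMain_div
    have hmid : Tendsto (fun n => (expectedCorrect n (g n) - S n - bottomTerm n) / √(n : ℝ))
        atTop (nhds 0) := by
      refine hdiv (c := 4) ?_ ?_
      · filter_upwards [eventually_ge_atTop 26] with n hn
        have := (expectedCorrect_bounds hn (hg n)).1
        linarith
      · filter_upwards [eventually_ge_atTop 26] with n hn
        have := (expectedCorrect_bounds hn (hg n)).2
        linarith
    have hbot : Tendsto (fun n => bottomTerm n / √(n : ℝ)) atTop (nhds 0) :=
      hdiv (c := 1) (.of_forall bottomTerm_nonneg) (.of_forall bottomTerm_le_one)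
    have hE : Tendsto (fun n => expectedCorrect n (g n) / √(n : ℝ)) atTop (nhds s) := by
      have := (hmid.add hS).add hbot
      rw [zero_add, add_zero] at this
      refine this.congr fun n => ?_
      ring
    have hR : Tendsto (fun n : ℕ => (s * √((n : ℝ) - √(n : ℝ)) + a + bottomTerm n) / √(n : ℝ))
        atTop (nhds s) := by
      have := ((hgrow.const_mul s).add (hsqrt.const_div_atTop a)).add hbot
      rw [mul_one, add_zero, add_zero] at this
      refine this.congr fun n => ?_
      ring
    have hratio := hE.div hR hs0.ne'
    rw [div_self hs0.ne'] at hratio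
    have hpos : ∀ᶠ n : ℕ in atTop, s * √((n : ℝ) - √(n : ℝ)) + a + bottomTerm n ≠ 0 := by
      filter_upwards [hR.eventually_const_lt hs0] with n hn h0
      simp [h0] at hn
    simp only [ha, add_sub_assoc] at hpos hratio ⊢
    refine (isEquivalent_iff_tendsto_one ?_).mpr (hratio.congr' ?_)
    · exact hpos
    · filter_upwards [eventually_gt_atTop 0] with n hn
      have hn' : (0 : ℝ) < n := by exact_mod_cast hn
      simp only [Pi.div_apply]
      rw [div_div_div_cancel_right₀ (by positivity)]
  · intro ε hε
    have hc : 0 < Real.exp (-2) * (2 * Real.pi) ^ (-(1 / 2) : ℝ) := by positivity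
    have htop : Tendsto (fun n : ℕ => √((n : ℝ) - √(n : ℝ))) atTop atTop := by
      refine (hgrow.pos_mul_atTop one_pos hsqrt).congr' ?_
      filter_upwards [eventually_gt_atTop 0] with n hn
      have hn' : (0 : ℝ) < n := by exact_mod_cast hn
      rw [div_mul_cancel₀ _ (by positivity)]
    have := (htop.const_mul_atTop hc).const_mul_atTop (show 0 < 1 + ε by linarith)
    filter_upwards [this.eventually_ge_atTop 1] with n hn
    rw [← Real.sqrt_eq_rpow]
    exact (bottomTerm_le_one n).trans hn
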